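/- **Theorem (Classification of Covering Maps).** Let $X$ be a path connected and locally path connected space that is semi-locally simply connected: every neighborhood of every point $x\in X$ contains a neighborhood $U$ of $x$ such that every loop at $x$ in $U$ is null-homotopic in $X$ (relative to its base point). Let $\pi(X)$ be the fundamental groupoid of $X$; its objects are the points of $X$ and its morphisms $x_0\to x_1$ are the path homotopy classes of paths from $x_0$ to $x_1$, composed by concatenation. Let $\mathrm{Cov}(X)$ be the category whose objects are the covering maps $p\colon Y\to X$ (each point of $X$ has an open neighborhood $U$ with $p^{-1}(U)\cong U\times D$ over $U$ for some discrete space $D$, where $D=\emptyset$ is allowed) and whose morphisms are the continuous maps over $X$. * The monodromy functor of a covering map $p\colon Y\to X$ is the functor $F(p)\colon\pi(X)\to\mathbf{Set}$ with $F(p)(x)=p^{-1}(x)$, in which the class of a path $u$ from $x_0$ to $x_1$ sends $y\in p^{-1}(x_0)$ to $y\cdot[u]$, the end point of the lift of $u$ starting at $y$. A morphism of covering maps is sent to the natural transformation given by its restrictions to the fibres. * For a functor $F\colon\pi(X)\to\mathbf{Set}$ let $Y(F)=\coprod_{x\in X}F(x)$, let $p(F)\colon Y(F)\to X$ send $F(x)$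 to $x$, and give $Y(F)$ the topology generated by the sets $(U,y)=\{F([u])(y) \mid u \text{ a path in } U \text{ starting at } x\}$, where $x\in X$, $y\in F(x)$, and $U$ is an open path connected neighborhood of $x$ such that every loop at $x$ in $U$ is null-homotopic in $X$. A natural transformation $F\Rightarrow G$ is sent to the induced map $Y(F)\to Y(G)$. Then: 1. For every functor $F\colon\pi(X)\to\mathbf{Set}$ the map $p(F)\colon Y(F)\to X$ is a covering map, and the functors $$\mathrm{Cov}(X)\rightleftarrows\mathrm{Func}(\pi(X),\mathbf{Set}),\qquad p\mapsto F(p),\qquad F\mapsto (p(F)\colon Y(F)\to X)$$ are equivalences of categories, inverse to each other up to canonical natural isomorphism: the bijections $Y\to Y(F(p))=\coprod_{x} p^{-1}(x)$, $y\mapsto (p(y),y)$, are isomorphisms of covering spaces, natural in $p$, and the bijections $F(p(F))(x)=\{x\}\times F(x)\to F(x)$, $(x,a)\mapsto a$, form an isomorphism of functors, natural in $F$. 2. A covering map $p$ is surjective if and only if all the sets $F(p)(x)$ are non-empty, and $p(F)$ is surjective if and only if all the sets $F(x)$ are non-empty; so surjective covering maps correspond to functors with non-empty values. 3. For every $x_0\in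 X$ the functor $(p\colon Y\to X)\mapsto p^{-1}(x_0)$, with the right action $(y,[u])\mapsto y\cdot[u]$ of $\pi_1(X,x_0)$ (where $[u]\cdot[v]$ is the class of $u$ followed by $v$), is an equivalence from $\mathrm{Cov}(X)$ to the category of right $\pi_1(X,x_0)$-sets and equivariant maps. A covering map $p$ is surjective if and only if $p^{-1}(x_0)$ is non-empty. -/

import Mathlib

open CategoryTheory

universe u

/-- Every neighborhood of every point `x` contains a neighborhood `U` of `x` such that every loop
at `x` in `U` is contractible in `X`. -/
def SemilocallySimplyConnected (X : Type u) [TopologicalSpace X] : Prop :=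
  ∀ x : X, ∀ N ∈ nhds x, ∃ U ∈ nhds x, U ⊆ N ∧
    ∀ γ : Path x x, (∀ t, γ t ∈ U) → γ.Homotopic (Path.refl x)

/-- A covering space of `X`. The fibres are allowed to be empty (so over a path connected `X` the
only difference with surjective covering maps is the empty covering). -/
structure Cov (X : Type u) [TopologicalSpace X] where
  total : Type u
  [top : TopologicalSpace total]
  proj : total → X
  isCov : IsCoveringMap proj

namespace Cov

variable {X : Type u} [TopologicalSpace X]

instance (C : Cov X) : TopologicalSpace C.total := C.top

/-- A morphism of covering spaces: a continuous map over `X`. -/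
structure Hom (C D : Cov X) where
  toFun : C.total → D.total
  continuous_toFun : Continuous toFun
  proj_toFun : ∀ y, D.proj (toFun y) = C.proj y

instance : Category (Cov X) where
  Hom := Hom
  id C := ⟨id, continuous_id, fun _ => rfl⟩
  comp f g := ⟨g.toFun ∘ f.toFun, g.continuous_toFun.comp f.continuous_toFun,
    fun y => (g.proj_toFun _).trans (f.proj_toFun y)⟩

/-- A morphism of covering spaces commutes with sliding fibres along paths. -/
theorem monodromy_hom {C D : Cov X} (f : C ⟶ D) {x x' : X} (γ : Path.Homotopic.Quotient x x')
    (e : C.proj ⁻¹' {x}) :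
    D.isCov.monodromy γ ⟨f.toFun e.1, (f.proj_toFun e.1).trans e.2⟩ =
      ⟨f.toFun (C.isCov.monodromy γ e).1,
        (f.proj_toFun _).trans (C.isCov.monodromy γ e).2⟩ := by
  obtain ⟨γ⟩ := γ
  have h0 : γ.toContinuousMap 0 = C.proj e.1 := γ.source.trans e.2.symm
  have h0' : γ.toContinuousMap 0 = D.proj (f.toFun e.1) := h0.trans (f.proj_toFun _).symm
  have key : f.toFun ∘ (C.isCov.liftPath γ.toContinuousMap e.1 h0)
      = D.isCov.liftPath γ.toContinuousMap (f.toFun e.1) h0' := by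
    refine (D.isCov.eq_liftPath_iff h0').2 ⟨f.continuous_toFun.comp (map_continuous _), ?_, ?_⟩
    · rw [← Function.comp_assoc, show D.proj ∘ f.toFun = C.proj from funext f.proj_toFun]
      exact C.isCov.liftPath_lifts _ _ h0
    · exact congrArg f.toFun (C.isCov.liftPath_zero _ _ h0)
  exact Subtype.ext (congrFun key 1).symm

/-- The functor `Cov(X) → Func(π(X), Set)` taking a covering map `p` to its monodromy functor
`x ↦ p⁻¹(x)`, and a map of covering spaces to its restrictions to the fibres. -/
noncomputable def monodromyFunctor (X : Type u) [TopologicalSpace X] :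
    Cov X ⥤ (FundamentalGroupoid X ⥤ Type u) where
  obj C := C.isCov.monodromyFunctor
  map {C D} f :=
    { app := fun x => TypeCat.ofHom
        (fun e : C.proj ⁻¹' {x.as} =>
          (⟨f.toFun e.1, (f.proj_toFun e.1).trans e.2⟩ : D.proj ⁻¹' {x.as}))
      naturality := by
        intro x x' γ
        ext e
        exact (monodromy_hom f γ e).symm }
  map_id _ := rfl
  map_comp _ _ := rfl

end Cov

/-- The disjoint union `Y(F)` of the sets `F(x)`, `x ∈ X`. -/
structure CoverSpace {X : Type u} [TopologicalSpace X] (F : FundamentalGroupoid X ⥤ Type u) where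
  pt : X
  val : F.obj ⟨pt⟩

namespace CoverSpace

variable {X : Type u} [TopologicalSpace X]

/-- `U` is an open path connected neighborhood of `x` such that every loop at `x` in `U` is
nullhomotopic in `X`. -/
structure IsGoodNhd (U : Set X) (x : X) : Prop where
  isOpen : IsOpen U
  mem : x ∈ U
  isPathConnected : IsPathConnected U
  loop_null : ∀ γ : Path x x, (∀ t, γ t ∈ U) → γ.Homotopic (Path.refl x)

/-- The morphism of the fundamental groupoid represented by a path. -/
def pathHom {x z : X} (γ : Path x z) : FundamentalGroupoid.mk x ⟶ FundamentalGroupoid.mk z :=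
  FundamentalGroupoid.fromPath (Path.Homotopic.Quotient.mk γ)

/-- The set `(U, y)` of all `(z, F(u)(y))` where `u` is a path in `U` from `x` to `z`. -/
def sheet (F : FundamentalGroupoid X ⥤ Type u) (U : Set X) {x : X} (y : F.obj ⟨x⟩) :
    Set (CoverSpace F) :=
  {w | ∃ γ : Path x w.pt, (∀ t, γ t ∈ U) ∧ F.map (pathHom γ) y = w.val}

/-- The topology on `Y(F)` generated by the sets `(U, y)`. -/
instance (F : FundamentalGroupoid X ⥤ Type u) : TopologicalSpace (CoverSpace F) :=
  TopologicalSpace.generateFrom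
    {S | ∃ (U : Set X) (x : X) (y : F.obj ⟨x⟩), IsGoodNhd U x ∧ S = sheet F U y}

/-- The map `Y(F) → Y(G)` induced by a natural transformation. -/
def map {F G : FundamentalGroupoid X ⥤ Type u} (τ : F ⟶ G) (w : CoverSpace F) : CoverSpace G :=
  ⟨w.pt, τ.app ⟨w.pt⟩ w.val⟩

theorem continuous_map {F G : FundamentalGroupoid X ⥤ Type u} (τ : F ⟶ G) :
    Continuous (map τ) := by
  refine continuous_generateFrom_iff.2 ?_
  rintro _ ⟨U, x, y, hU, rfl⟩
  have : map τ ⁻¹' sheet G U y = ⋃ (y' : F.obj ⟨x⟩) (_ : τ.app ⟨x⟩ y' = y), sheet F U y' := by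
    ext ⟨z, a⟩
    simp only [Set.mem_preimage, Set.mem_iUnion]
    constructor
    · rintro ⟨(γ : Path x z), hγ, (h : G.map (pathHom γ) y = τ.app ⟨z⟩ a)⟩
      refine ⟨F.map (Groupoid.inv (pathHom γ)) a, ?_, γ, hγ, ?_⟩
      · rw [NatTrans.naturality_apply, ← h, ← Functor.map_comp_apply, Groupoid.comp_inv,
          Functor.map_id_apply]
      · change F.map (pathHom γ) (F.map (Groupoid.inv (pathHom γ)) a) = a
        rw [← Functor.map_comp_apply, Groupoid.inv_comp, Functor.map_id_apply]
    · rintro ⟨y', rfl, (γ : Path x z), hγ, (h : F.map (pathHom γ) y' = a)⟩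
      refine ⟨γ, hγ, ?_⟩
      change G.map (pathHom γ) (τ.app ⟨x⟩ y') = τ.app ⟨z⟩ a
      rw [← h, NatTrans.naturality_apply]
  rw [this]
  exact isOpen_iUnion fun y' => isOpen_iUnion fun _ =>
    TopologicalSpace.isOpen_generateFrom_of_mem ⟨U, x, y', hU, rfl⟩

/-- The functor `F ↦ (Y(F) → X)` from `Func(π(X), Set)` to `Cov(X)`, once all the projections
`Y(F) → X` are known to be covering maps. -/
def functor (h : ∀ F : FundamentalGroupoid X ⥤ Type u, IsCoveringMap (pt : CoverSpace F → X)) :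
    (FundamentalGroupoid X ⥤ Type u) ⥤ Cov X where
  obj F := ⟨CoverSpace F, pt, h F⟩
  map τ := ⟨map τ, continuous_map τ, fun _ => rfl⟩
  map_id _ := rfl
  map_comp _ _ := rfl

end CoverSpace

/-- A set with a right action of `π₁(X, x₀)`, where the product of two homotopy classes of loops
is the class of the first loop followed by the second. -/
structure RightPiOneSet (X : Type u) [TopologicalSpace X] (x₀ : X) where
  carrier : Type u
  act : carrier → Path.Homotopic.Quotient x₀ x₀ → carrier
  act_one : ∀ s, act s (Path.Homotopic.Quotient.refl x₀) = s
  act_mul : ∀ s a b, act s (a.trans b) = act (act s a) b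

namespace RightPiOneSet

variable {X : Type u} [TopologicalSpace X] {x₀ : X}

/-- An equivariant map. -/
structure Hom (S T : RightPiOneSet X x₀) where
  toFun : S.carrier → T.carrier
  map_act : ∀ s a, toFun (S.act s a) = T.act (toFun s) a

instance : Category (RightPiOneSet X x₀) where
  Hom := Hom
  id S := ⟨id, fun _ _ => rfl⟩
  comp f g := ⟨g.toFun ∘ f.toFun, fun s a =>
    (congrArg g.toFun (f.map_act s a)).trans (g.map_act _ a)⟩

end RightPiOneSet

/-- The functor taking a covering map `p` to the fibre `p⁻¹(x₀)` with the right monodromy action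
of `π₁(X, x₀)`, in which `y · [u]` is the end point of the lift of `u` starting at `y`. -/
noncomputable def Cov.fibreFunctor (X : Type u) [TopologicalSpace X] (x₀ : X) :
    Cov X ⥤ RightPiOneSet X x₀ where
  obj C :=
    { carrier := C.proj ⁻¹' {x₀}
      act := fun e a => C.isCov.monodromy a e
      act_one := fun e => congrFun C.isCov.monodromy_refl e
      act_mul := fun e a b => C.isCov.monodromy_trans_apply a b e }
  map f :=
    { toFun := fun e => ⟨f.toFun e.1, (f.proj_toFun e.1).trans e.2⟩
      map_act := fun e a => (Cov.monodromy_hom f a e).symm }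
  map_id _ := rfl
  map_comp _ _ := rfl

/-!
Inside a good neighborhood `U` of `x` there is only one homotopy class (in `X`) of paths from `x`
to a given point, so moving fibres to `F(x)` along paths in `U` trivializes `Y(F)` over `U`.

A map into `Y(F)` whose values are carried to each other by `F` is continuous as soon as its domain
is locally path connected, because the sheets `(U, y)` are stable under such a transport. For
`t ↦ F([u|_{[0,t]}])(y)` this gives the lift of a path `u` to `Y(F)`, so the monodromy of `Y(F)` is
`F` again. For `y ↦ (p(y), y)` it gives continuity of the bijection `Y → Y(F(p))`; being a map
between covering spaces over `X`, it is then a local homeomorphism, hence a homeomorphism.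

If `X` is path connected, the inclusion of `π₁(X, x₀)`, as a category with one object, into `π(X)`
is an equivalence. Precomposition with it turns functors on `π(X)` into right `π₁(X, x₀)`-sets, and
monodromy functors into fibres over `x₀`.
-/

theorem SemilocallySimplyConnected.exists_isGoodNhd {X : Type u} [TopologicalSpace X]
    [LocallyPathConnectedSpace X] (hX : SemilocallySimplyConnected X) {x : X} {N : Set X}
    (hN : N ∈ nhds x) : ∃ U ⊆ N, CoverSpace.IsGoodNhd U x := by
  obtain ⟨V, hV, hVN, hloop⟩ := hX x N hN
  have hsub : pathComponentIn (interior V) x ⊆ V := pathComponentIn_subset.trans interior_subset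
  have hx : x ∈ interior V := mem_interior_iff_mem_nhds.2 hV
  exact ⟨pathComponentIn (interior V) x, hsub.trans hVN, isOpen_interior.pathComponentIn x,
    mem_pathComponentIn_self hx, isPathConnected_pathComponentIn hx,
    fun γ hγ => hloop γ fun t => hsub (hγ t)⟩

theorem locallyPathConnectedSpace_of_isLocalHomeomorph {Y X : Type*} [TopologicalSpace Y]
    [TopologicalSpace X] [LocallyPathConnectedSpace X] {p : Y → X} (hp : IsLocalHomeomorph p) :
    LocallyPathConnectedSpace Y := by
  choose e he _ using hp
  let _ : ChartedSpace X Y :=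
    { atlas := Set.range e
      chartAt := e
      mem_chart_source := he
      chart_mem_atlas := Set.mem_range_self }
  exact ChartedSpace.locallyPathConnectedSpace X Y

theorem surjective_iff_nonempty_fibre_of_isCoveringMap {Y X : Type*} [TopologicalSpace Y]
    [TopologicalSpace X] [PathConnectedSpace X] {p : Y → X} (hp : IsCoveringMap p) (x₀ : X) :
    Function.Surjective p ↔ Nonempty (p ⁻¹' {x₀}) := by
  refine ⟨fun h => nonempty_subtype.2 (h x₀), fun ⟨y⟩ x => ?_⟩
  exact nonempty_subtype.1 ⟨hp.monodromy (.mk (PathConnectedSpace.somePath x₀ x)) y⟩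

namespace CoverSpace

variable {X : Type u} [TopologicalSpace X] {F : FundamentalGroupoid X ⥤ Type u}

theorem pathHom_trans {x y z : X} (γ : Path x y) (δ : Path y z) :
    pathHom (γ.trans δ) = pathHom γ ≫ pathHom δ := rfl

theorem pathHom_eq {x y : X} {γ δ : Path x y} (h : γ.Homotopic δ) : pathHom γ = pathHom δ :=
  Quotient.sound h

theorem trans_mem {U : Set X} {x y z : X} {γ : Path x y} {δ : Path y z} (hγ : ∀ t, γ t ∈ U)
    (hδ : ∀ t, δ t ∈ U) (t : unitInterval) : γ.trans δ t ∈ U := by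
  rw [Path.trans_apply]
  split_ifs
  exacts [hγ _, hδ _]

theorem pt_mem_of_mem_sheet {U : Set X} {x : X} {y : F.obj ⟨x⟩} {w : CoverSpace F}
    (hw : w ∈ sheet F U y) : w.pt ∈ U := by
  obtain ⟨γ, hγ, -⟩ := hw
  simpa only [γ.target] using hγ 1

theorem mem_sheet_self {U : Set X} {w : CoverSpace F} (hw : w.pt ∈ U) : w ∈ sheet F U w.val :=
  ⟨Path.refl _, fun _ => hw, Functor.map_id_apply F _ _⟩

theorem sheet_subset_sheet {U : Set X} {x : X} {y : F.obj ⟨x⟩} {w : CoverSpace F}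
    (hw : w ∈ sheet F U y) : sheet F U w.val ⊆ sheet F U y := by
  obtain ⟨γ, hγ, h⟩ := hw
  rintro v ⟨δ, hδ, h'⟩
  exact ⟨γ.trans δ, trans_mem hγ hδ, by rw [pathHom_trans, Functor.map_comp_apply, h, h']⟩

theorem isOpen_sheet {U : Set X} {x : X} (hU : IsGoodNhd U x) (y : F.obj ⟨x⟩) :
    IsOpen (sheet F U y) :=
  TopologicalSpace.isOpen_generateFrom_of_mem ⟨U, x, y, hU, rfl⟩

theorem continuous_pt [LocallyPathConnectedSpace X] (hX : SemilocallySimplyConnected X) :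
    Continuous (pt : CoverSpace F → X) := by
  refine continuous_def.2 fun W hW => isOpen_iff_forall_mem_open.2 fun w hw => ?_
  obtain ⟨U, hUW, hU⟩ := hX.exists_isGoodNhd (hW.mem_nhds hw)
  exact ⟨sheet F U w.val, fun v hv => hUW (pt_mem_of_mem_sheet hv), isOpen_sheet hU _,
    mem_sheet_self hU.mem⟩

/-- A map `s` into `Y(F)` lying over a continuous map is flat if `F`, applied to the image of any
path from `a` to `b`, carries the value of `s` at `a` to its value at `b`. Local sections of
`Y(F)`, lifts of maps to `Y(F)` and the unit `Y → Y(F(p))` are all of this form. -/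
def IsFlat {A : Type*} [TopologicalSpace A] (s : A → CoverSpace F)
    (hs : Continuous fun a => (s a).pt) : Prop :=
  ∀ ⦃a b : A⦄ (δ : Path a b), F.map (pathHom (δ.map hs)) (s a).val = (s b).val

theorem IsFlat.continuous {A : Type*} [TopologicalSpace A] [LocallyPathConnectedSpace A]
    {s : A → CoverSpace F} {hs : Continuous fun a => (s a).pt} (h : IsFlat s hs) :
    Continuous s := by
  refine continuous_iff_continuousAt.2 fun a => ?_
  refine TopologicalSpace.tendsto_nhds_generateFrom_iff.2 ?_
  rintro _ ⟨U, x, y, hU, rfl⟩ ha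
  have hmem := pathComponentIn_mem_nhds
    ((hU.isOpen.preimage hs).mem_nhds (pt_mem_of_mem_sheet ha : a ∈ (fun b => (s b).pt) ⁻¹' U))
  refine Filter.mem_of_superset hmem ?_
  rintro b ⟨δ, hδ⟩
  exact sheet_subset_sheet ha ⟨δ.map hs, hδ, h δ⟩

namespace IsGoodNhd

variable {U : Set X} {x : X} (hU : IsGoodNhd U x)
include hU

/-- The morphism `x ⟶ z` of the fundamental groupoid represented by the paths from `x` to `z`
inside the good neighborhood `U`. -/
noncomputable def hom {z : X} (hz : z ∈ U) : FundamentalGroupoid.mk x ⟶ FundamentalGroupoid.mk z :=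
  pathHom (hU.isPathConnected.joinedIn x hU.mem z hz).somePath

theorem pathHom_eq_hom {z : X} (hz : z ∈ U) {γ : Path x z} (hγ : ∀ t, γ t ∈ U) :
    pathHom γ = hU.hom hz := by
  let δ := (hU.isPathConnected.joinedIn x hU.mem z hz).somePath
  have hδ : ∀ t, δ.symm t ∈ U := fun t => JoinedIn.somePath_mem _ _
  have hloop : pathHom γ ≫ Groupoid.inv (pathHom δ) = 𝟙 _ :=
    pathHom_eq (hU.loop_null (γ.trans δ.symm) (trans_mem hγ hδ))
  rw [Groupoid.inv_eq_inv, IsIso.comp_inv_eq, Category.id_comp] at hloop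
  exact hloop

theorem hom_comp_pathHom {z z' : X} (hz : z ∈ U) (hz' : z' ∈ U) {δ : Path z z'}
    (hδ : ∀ t, δ t ∈ U) : hU.hom hz ≫ pathHom δ = hU.hom hz' :=
  hU.pathHom_eq_hom hz' (trans_mem (JoinedIn.somePath_mem _) hδ)

theorem mem_sheet_iff {y : F.obj ⟨x⟩} {w : CoverSpace F} (hw : w.pt ∈ U) :
    w ∈ sheet F U y ↔ F.map (hU.hom hw) y = w.val := by
  constructor
  · rintro ⟨γ, hγ, h⟩
    rwa [← hU.pathHom_eq_hom hw hγ]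
  · exact fun h => ⟨_, JoinedIn.somePath_mem _, h⟩

/-- The local section of `Y(F)` over the good neighborhood `U` through the point `y` over `x`;
its image is the sheet `(U, y)`. -/
noncomputable def localSection (y : F.obj ⟨x⟩) (z : U) : CoverSpace F :=
  ⟨z, F.map (hU.hom z.2) y⟩

theorem continuous_localSection [LocallyPathConnectedSpace X] (y : F.obj ⟨x⟩) :
    Continuous (hU.localSection y) := by
  have := hU.isOpen.locallyPathConnectedSpace
  have hflat : IsFlat (hU.localSection y) continuous_subtype_val := fun z z' δ => by
    have hδ : ∀ t, (δ.map continuous_subtype_val) t ∈ U := fun t => (δ t).2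
    exact (Functor.map_comp_apply F _ _ y).symm.trans
      (congrArg (F.map · y) (hU.hom_comp_pathHom z.2 z'.2 hδ))
  exact hflat.continuous

/-- The trivialization of `Y(F)` over the good neighborhood `U` of `x`, which moves the fibres to
`F(x)` along paths in `U`. -/
noncomputable def trivialization [LocallyPathConnectedSpace X]
    (hX : SemilocallySimplyConnected X) [TopologicalSpace (F.obj ⟨x⟩)]
    [DiscreteTopology (F.obj ⟨x⟩)] :
    (pt : CoverSpace F → X) ⁻¹' U ≃ₜ U × F.obj ⟨x⟩ where
  toFun w := (⟨w.1.pt, w.2⟩, F.map (inv (hU.hom w.2)) w.1.val)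
  invFun v := ⟨hU.localSection v.2 v.1, v.1.2⟩
  left_inv w := by simp [localSection]
  right_inv v := Prod.ext rfl <| by
    change F.map (inv (hU.hom v.1.2)) (F.map (hU.hom v.1.2) v.2) = v.2
    rw [← Functor.map_comp_apply, IsIso.hom_inv_id, Functor.map_id_apply]
  continuous_toFun := by
    refine (((continuous_pt hX).comp continuous_subtype_val).subtype_mk _).prodMk
      (continuous_discrete_rng.2 fun y => ?_)
    have hpre : (fun w : (pt : CoverSpace F → X) ⁻¹' U => F.map (inv (hU.hom w.2)) w.1.val) ⁻¹' {y}
        = Subtype.val ⁻¹' sheet F U y := by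
      ext w
      rw [Set.mem_preimage, Set.mem_singleton_iff, Set.mem_preimage, hU.mem_sheet_iff w.2]
      constructor
      · rintro rfl
        simp
      · intro h
        simp [← h]
    exact hpre ▸ (isOpen_sheet hU y).preimage continuous_subtype_val
  continuous_invFun := (continuous_prod_of_discrete_right.2
    fun y => hU.continuous_localSection y).subtype_mk _

end IsGoodNhd

theorem isCoveringMap_pt [LocallyPathConnectedSpace X] (hX : SemilocallySimplyConnected X)
    (F : FundamentalGroupoid X ⥤ Type u) : IsCoveringMap (pt : CoverSpace F → X) := by
  intro x
  obtain ⟨U, -, hU⟩ := hX.exists_isGoodNhd (Filter.univ_mem (f := nhds x))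
  let _ : TopologicalSpace (F.obj ⟨x⟩) := ⊥
  have : DiscreteTopology (F.obj ⟨x⟩) := ⟨rfl⟩
  exact IsEvenlyCovered.to_isEvenlyCovered_preimage ⟨‹_›, U, hU.mem, hU.isOpen,
    hU.isOpen.preimage (continuous_pt hX), hU.trivialization hX, fun _ => rfl⟩

section Lift

variable {A : Type*} [TopologicalSpace A] [SimplyConnectedSpace A]

/-- The lift to `Y(F)` of a map `f : A → X` out of a simply connected space which sends `a₀` to
the point `y` over `f a₀`. The choice of the path from `a₀` to `a` does not matter, see
`CoverSpace.lift_val`. -/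
noncomputable def lift (f : C(A, X)) (a₀ : A) (y : F.obj ⟨f a₀⟩) (a : A) : CoverSpace F :=
  ⟨f a, F.map (pathHom ((PathConnectedSpace.somePath a₀ a).map f.continuous)) y⟩

theorem lift_val (f : C(A, X)) {a₀ a : A} (y : F.obj ⟨f a₀⟩) (γ : Path a₀ a) :
    (lift f a₀ y a).val = F.map (pathHom (γ.map f.continuous)) y := by
  rw [pathHom_eq ((SimplyConnectedSpace.paths_homotopic γ _).map f)]
  rfl

theorem lift_self (f : C(A, X)) (a₀ : A) (y : F.obj ⟨f a₀⟩) : lift f a₀ y a₀ = ⟨f a₀, y⟩ :=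
  congrArg (CoverSpace.mk (f a₀))
    ((lift_val f y (Path.refl a₀)).trans (Functor.map_id_apply F _ y))

theorem continuous_lift [LocallyPathConnectedSpace A] (f : C(A, X)) (a₀ : A)
    (y : F.obj ⟨f a₀⟩) : Continuous (lift f a₀ y) := by
  have hflat : IsFlat (lift f a₀ y) f.continuous := fun a b δ => by
    rw [lift_val f y ((PathConnectedSpace.somePath a₀ a).trans δ), Path.map_trans, pathHom_trans,
      Functor.map_comp_apply]
    rfl
  exact hflat.continuous

end Lift

theorem monodromy_pt (hF : IsCoveringMap (pt : CoverSpace F → X)) {x z : X} (γ : Path x z)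
    (y : F.obj ⟨x⟩) :
    hF.monodromy (.mk γ) ⟨⟨x, y⟩, rfl⟩ = ⟨⟨z, F.map (pathHom γ) y⟩, rfl⟩ := by
  have : ContractibleSpace unitInterval :=
    (convex_Icc (0 : ℝ) 1).contractibleSpace ⟨0, unitInterval.zero_mem⟩
  have : LocallyPathConnectedSpace unitInterval := (convex_Icc (0 : ℝ) 1).locallyPathConnectedSpace
  obtain ⟨f, rfl, rfl⟩ := γ
  let idPath : Path (0 : unitInterval) 1 := ⟨.id _, rfl, rfl⟩
  let Γ : Path (⟨f 0, y⟩ : CoverSpace F) ⟨f 1, F.map (pathHom ⟨f, rfl, rfl⟩) y⟩ :=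
    { toFun := lift f 0 y
      continuous_toFun := continuous_lift f 0 y
      source' := lift_self f 0 y
      target' := congrArg (CoverSpace.mk (f 1)) (lift_val f y idPath) }
  exact hF.monodromy_map (.mk Γ)

/-- The bijection `F(p(F))(x) = {x} × F(x) → F(x)`. -/
noncomputable def fibreEquiv (F : FundamentalGroupoid X ⥤ Type u) (x : X) :
    (pt : CoverSpace F → X) ⁻¹' {x} ≃ F.obj ⟨x⟩ where
  toFun w := F.map (eqToHom (congrArg FundamentalGroupoid.mk w.2)) w.1.val
  invFun a := ⟨⟨x, a⟩, rfl⟩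
  left_inv := by
    rintro ⟨⟨z, a⟩, (rfl : z = x)⟩
    simp
  right_inv a := by simp

theorem fibreEquiv_mk (F : FundamentalGroupoid X ⥤ Type u) (x : X) (a : F.obj ⟨x⟩) :
    fibreEquiv F x ⟨⟨x, a⟩, rfl⟩ = a :=
  (fibreEquiv F x).apply_symm_apply a

theorem surjective_pt_iff : Function.Surjective (pt : CoverSpace F → X) ↔
    ∀ x, Nonempty (F.obj x) :=
  ⟨fun h x => (fibreEquiv F x.as).nonempty_congr.1 (nonempty_subtype.2 (h x.as)),
    fun h x => nonempty_subtype.1 ((fibreEquiv F x).nonempty_congr.2 (h ⟨x⟩))⟩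

end CoverSpace

namespace Cov

variable {X : Type u} [TopologicalSpace X]

theorem surjective_proj_iff (C : Cov X) : Function.Surjective C.proj ↔
    ∀ x, Nonempty (((monodromyFunctor X).obj C).obj x) :=
  ⟨fun h x => nonempty_subtype.2 (h x.as), fun h x => nonempty_subtype.1 (h ⟨x⟩)⟩

attribute [ext] Hom

/-- A homeomorphism over `X` as an isomorphism of covering spaces. -/
def isoOfHomeomorph {C D : Cov X} (e : C.total ≃ₜ D.total) (he : ∀ y, D.proj (e y) = C.proj y) :
    C ≅ D where
  hom := (⟨e, e.continuous, he⟩ : Hom C D)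
  inv := (⟨e.symm, e.symm.continuous, fun y => by rw [← he, e.apply_symm_apply]⟩ : Hom D C)
  hom_inv_id := Hom.ext e.symm_comp_self
  inv_hom_id := Hom.ext e.self_comp_symm

/-- The canonical map `Y → Y(F(p))`, `y ↦ (p(y), y)`. -/
def unit (C : Cov X) (y : C.total) : CoverSpace ((monodromyFunctor X).obj C) :=
  ⟨C.proj y, ⟨y, rfl⟩⟩

theorem unit_eq {C : Cov X} {x : X} (y : C.proj ⁻¹' {x}) : C.unit y = ⟨x, y⟩ := by
  obtain ⟨y, rfl⟩ := y
  rfl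

theorem unit_bijective (C : Cov X) : Function.Bijective C.unit := by
  let point (w : CoverSpace ((monodromyFunctor X).obj C)) : C.total :=
    (show C.proj ⁻¹' {w.pt} from w.val).1
  exact Function.bijective_iff_has_inverse.2 ⟨point, fun _ => rfl, fun w => unit_eq w.val⟩

theorem continuous_unit [LocallyPathConnectedSpace X] (C : Cov X) : Continuous C.unit := by
  have := locallyPathConnectedSpace_of_isLocalHomeomorph C.isCov.isLocalHomeomorph
  have hflat : CoverSpace.IsFlat C.unit C.isCov.continuous :=
    fun _ _ δ => C.isCov.monodromy_map (.mk δ)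
  exact hflat.continuous

theorem isLocalHomeomorph_unit [LocallyPathConnectedSpace X] (C : Cov X)
    (hC : IsCoveringMap (CoverSpace.pt : CoverSpace ((monodromyFunctor X).obj C) → X)) :
    IsLocalHomeomorph C.unit :=
  .of_comp (g := CoverSpace.pt) C.isCov.isLocalHomeomorph hC.isLocalHomeomorph C.continuous_unit

section

variable (hcov : ∀ F : FundamentalGroupoid X ⥤ Type u,
  IsCoveringMap (CoverSpace.pt : CoverSpace F → X))

/-- The homeomorphism `Y → Y(F(p))`, `y ↦ (p(y), y)`. -/
noncomputable def unitHomeomorph [LocallyPathConnectedSpace X] (C : Cov X) :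
    C.total ≃ₜ CoverSpace ((monodromyFunctor X).obj C) :=
  (C.isLocalHomeomorph_unit (hcov _)).toHomeomorphOfBijective C.unit_bijective

/-- The isomorphisms `Y ≅ Y(F(p))` of covering spaces, natural in `p`. -/
noncomputable def unitIso [LocallyPathConnectedSpace X] :
    𝟭 (Cov X) ≅ monodromyFunctor X ⋙ CoverSpace.functor hcov :=
  NatIso.ofComponents
    (fun C => isoOfHomeomorph (D := (CoverSpace.functor hcov).obj _) (unitHomeomorph hcov C)
      fun _ => rfl)
    fun {C D} f => Hom.ext <| funext fun y =>
      unit_eq (C := D) (x := C.proj y) ⟨f.toFun y, f.proj_toFun y⟩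

/-- The isomorphisms `F(p(F)) ≅ F`, natural in `F`. -/
noncomputable def counitIso : CoverSpace.functor hcov ⋙ monodromyFunctor X ≅
    𝟭 (FundamentalGroupoid X ⥤ Type u) :=
  NatIso.ofComponents
    (fun F => NatIso.ofComponents (fun x => (CoverSpace.fibreEquiv F x.as).toIso) (by
      rintro ⟨x⟩ ⟨z⟩ ⟨γ⟩
      ext ⟨⟨x', a⟩, (rfl : x' = x)⟩
      calc CoverSpace.fibreEquiv F z ((hcov F).monodromy (.mk γ) ⟨⟨x', a⟩, rfl⟩)
          = F.map (CoverSpace.pathHom γ) a := by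
            rw [CoverSpace.monodromy_pt, CoverSpace.fibreEquiv_mk]
        _ = F.map (CoverSpace.pathHom γ) (CoverSpace.fibreEquiv F x' ⟨⟨x', a⟩, rfl⟩) := by
            rw [CoverSpace.fibreEquiv_mk]))
    (by
      intro F G τ
      ext ⟨x⟩ ⟨⟨x', a⟩, (rfl : x' = x)⟩
      calc CoverSpace.fibreEquiv G x' ⟨⟨x', τ.app ⟨x'⟩ a⟩, rfl⟩
          = τ.app ⟨x'⟩ a := CoverSpace.fibreEquiv_mk G x' _
        _ = τ.app ⟨x'⟩ (CoverSpace.fibreEquiv F x' ⟨⟨x', a⟩, rfl⟩) := by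
            rw [CoverSpace.fibreEquiv_mk])

/-- The equivalence `Cov(X) ≌ Func(π(X), Set)`. -/
noncomputable def monodromyEquivalence [LocallyPathConnectedSpace X] :
    Cov X ≌ (FundamentalGroupoid X ⥤ Type u) :=
  .mk (monodromyFunctor X) (CoverSpace.functor hcov) (unitIso hcov) (counitIso hcov)

end

end Cov

/-- The inclusion of the endomorphism monoid of `x`, as a category with one object. -/
def endInclusion {C : Type*} [Category C] (x : C) : SingleObj (End x) ⥤ C :=
  SingleObj.functor (MonoidHom.id (End x))

theorem isEquivalence_endInclusion {C : Type*} [Category C] (x : C) (h : ∀ y, Nonempty (x ≅ y)) :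
    (endInclusion x).IsEquivalence where
  faithful := ⟨id⟩
  full := ⟨fun f => ⟨f, rfl⟩⟩
  essSurj := ⟨fun y => ⟨SingleObj.star _, h y⟩⟩

theorem nonempty_fundamentalGroupoid_iso {X : Type*} [TopologicalSpace X] [PathConnectedSpace X]
    (x y : FundamentalGroupoid X) : Nonempty (x ≅ y) :=
  ⟨asIso (CoverSpace.pathHom (PathConnectedSpace.somePath x.as y.as))⟩

namespace RightPiOneSet

variable {X : Type u} [TopologicalSpace X] {x₀ : X}

attribute [ext] Hom

variable (X x₀) in
/-- A functor on `π₁(X, x₀)`, as a category with one object, is a right `π₁(X, x₀)`-set. It is a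
right action since the composition of the fundamental groupoid is concatenation of paths. -/
def ofSingleObj :
    (SingleObj (End (FundamentalGroupoid.mk x₀)) ⥤ Type u) ⥤ RightPiOneSet X x₀ where
  obj F :=
    { carrier := F.obj (SingleObj.star _)
      act := fun s a => F.map (X := SingleObj.star _) (Y := SingleObj.star _) a s
      act_one := fun s => Functor.map_id_apply F _ s
      act_mul := fun s _ _ => Functor.map_comp_apply F _ _ s }
  map τ :=
    { toFun := fun s => τ.app _ s
      map_act := fun s _ => NatTrans.naturality_apply τ _ s }
  map_id _ := rfl
  map_comp _ _ := rfl

/-- A right `π₁(X, x₀)`-set as a functor on `π₁(X, x₀)`. -/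
def toSingleObj (S : RightPiOneSet X x₀) :
    SingleObj (End (FundamentalGroupoid.mk x₀)) ⥤ Type u where
  obj _ := S.carrier
  map a := ↾(S.act · a)
  map_id _ := by ext s; exact S.act_one s
  map_comp _ _ := by ext s; exact S.act_mul s _ _

instance isEquivalence_ofSingleObj : (ofSingleObj X x₀).IsEquivalence where
  faithful := ⟨fun h => by
    ext _ s
    exact congrFun (congrArg Hom.toFun h) s⟩
  full := ⟨fun f => by
    refine ⟨{ app := fun _ => ↾f.toFun, naturality := fun _ _ a => ?_ }, rfl⟩
    ext s
    exact f.map_act s a⟩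
  essSurj := ⟨fun S => ⟨S.toSingleObj, ⟨Iso.refl _⟩⟩⟩

end RightPiOneSet

theorem Cov.isEquivalence_fibreFunctor {X : Type u} [TopologicalSpace X] [PathConnectedSpace X]
    [(Cov.monodromyFunctor X).IsEquivalence] (x₀ : X) :
    (Cov.fibreFunctor X x₀).IsEquivalence :=
  have := isEquivalence_endInclusion _ (nonempty_fundamentalGroupoid_iso (.mk x₀))
  inferInstanceAs (Cov.monodromyFunctor X ⋙
    (Functor.whiskeringLeft _ _ _).obj (endInclusion (.mk x₀)) ⋙
      RightPiOneSet.ofSingleObj X x₀).IsEquivalence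

theorem mainTheorem1_general (X : Type u) [TopologicalSpace X] [LocallyPathConnectedSpace X]
    (hX : SemilocallySimplyConnected X) :
    (∃ hcov : ∀ F : FundamentalGroupoid X ⥤ Type u,
        IsCoveringMap (CoverSpace.pt : CoverSpace F → X),
      (Cov.monodromyFunctor X).IsEquivalence ∧
      (CoverSpace.functor hcov).IsEquivalence ∧
      (∃ η : 𝟭 (Cov X) ≅ Cov.monodromyFunctor X ⋙ CoverSpace.functor hcov,
        ∀ (C : Cov X) (y : C.total), (η.hom.app C).toFun y = ⟨C.proj y, ⟨y, rfl⟩⟩) ∧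
      (∃ ε : CoverSpace.functor hcov ⋙ Cov.monodromyFunctor X ≅
          𝟭 (FundamentalGroupoid X ⥤ Type u),
        ∀ (F : FundamentalGroupoid X ⥤ Type u) (x : X) (a : F.obj ⟨x⟩),
          ((ε.hom.app F).app ⟨x⟩ : (CoverSpace.pt : CoverSpace F → X) ⁻¹' {x} → F.obj ⟨x⟩)
            ⟨⟨x, a⟩, rfl⟩ = a)) ∧
    (∀ C : Cov X, Function.Surjective C.proj ↔
      ∀ x, Nonempty (((Cov.monodromyFunctor X).obj C).obj x)) ∧
    (∀ F : FundamentalGroupoid X ⥤ Type u,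
      Function.Surjective (CoverSpace.pt : CoverSpace F → X) ↔ ∀ x, Nonempty (F.obj x)) ∧
    (∀ [PathConnectedSpace X] (x₀ : X), (Cov.fibreFunctor X x₀).IsEquivalence ∧
      ∀ C : Cov X, Function.Surjective C.proj ↔
        Nonempty ((Cov.fibreFunctor X x₀).obj C).carrier) := by
  have hcov := CoverSpace.isCoveringMap_pt hX
  let e := Cov.monodromyEquivalence hcov
  have hmon : (Cov.monodromyFunctor X).IsEquivalence := e.isEquivalence_functor
  refine ⟨⟨hcov, hmon, e.isEquivalence_inverse, ⟨Cov.unitIso hcov, fun _ _ => rfl⟩,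
    ⟨Cov.counitIso hcov, CoverSpace.fibreEquiv_mk⟩⟩, Cov.surjective_proj_iff,
    fun _ => CoverSpace.surjective_pt_iff, fun x₀ => ⟨Cov.isEquivalence_fibreFunctor x₀,
    fun C => surjective_iff_nonempty_fibre_of_isCoveringMap C.isCov x₀⟩⟩

theorem mainTheorem1 (X : Type u) [TopologicalSpace X] [PathConnectedSpace X]
    [LocallyPathConnectedSpace X] (hX : SemilocallySimplyConnected X) :
    -- the classification of covering maps
    (∃ hcov : ∀ F : FundamentalGroupoid X ⥤ Type u,
        IsCoveringMap (CoverSpace.pt : CoverSpace F → X),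
      (Cov.monodromyFunctor X).IsEquivalence ∧
      (CoverSpace.functor hcov).IsEquivalence ∧
      (∃ η : 𝟭 (Cov X) ≅ Cov.monodromyFunctor X ⋙ CoverSpace.functor hcov,
        ∀ (C : Cov X) (y : C.total), (η.hom.app C).toFun y = ⟨C.proj y, ⟨y, rfl⟩⟩) ∧
      (∃ ε : CoverSpace.functor hcov ⋙ Cov.monodromyFunctor X ≅
          𝟭 (FundamentalGroupoid X ⥤ Type u),
        ∀ (F : FundamentalGroupoid X ⥤ Type u) (x : X) (a : F.obj ⟨x⟩),
          ((ε.hom.app F).app ⟨x⟩ : (CoverSpace.pt : CoverSpace F → X) ⁻¹' {x} → F.obj ⟨x⟩)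
            ⟨⟨x, a⟩, rfl⟩ = a)) ∧
    -- surjective covering maps correspond to functors with non-empty values
    (∀ C : Cov X, Function.Surjective C.proj ↔
      ∀ x, Nonempty (((Cov.monodromyFunctor X).obj C).obj x)) ∧
    (∀ F : FundamentalGroupoid X ⥤ Type u,
      Function.Surjective (CoverSpace.pt : CoverSpace F → X) ↔ ∀ x, Nonempty (F.obj x)) ∧
    -- the equivalence with right sets over the fundamental group
    (∀ x₀ : X, (Cov.fibreFunctor X x₀).IsEquivalence ∧
      ∀ C : Cov X, Function.Surjective C.proj ↔
        Nonempty ((Cov.fibreFunctor X x₀).obj C).carrier) := by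
  obtain ⟨classification, surjective_proj, surjective_pt, fibre⟩ := mainTheorem1_general X hX
  exact ⟨classification, surjective_proj, surjective_pt, fun x₀ => fibre x₀⟩
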